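/- Let $(x,y)$, with pattern $x\in\mathbb{R}^d$ (or any measurable space) and label $y\in\{+1,-1\}$, follow a probability distribution $p(x,y)$. Write $\pi_+=p(y=+1)$, $r(x)=p(y=+1\mid x)$, and let $p(x\mid y=+1)$ be the positive class-conditional law. Let $\ell$ be a real loss function, let $R(g)=\mathbb{E}_{p(x,y)}[\ell(y\,g(x))]$ be the classification risk, and for $n\ge 1$ and $x_1,\dots,x_n$ drawn independently from $p(x\mid y=+1)$, with $r_i=r(x_i)$, let $$\widehat R(g)=\frac{\pi_+}{n}\sum_{i=1}^n\Big[\ell(g(x_i))+\frac{1-r_i}{r_i}\,\ell(-g(x_i))\Big].$$ Let $\mathcal{G}$ be a class of measurable real functions of $x$ such that $|g(x)|\le C_g$ for all $g\in\mathcal{G}$ and all $x$, where $C_g>0$. Assume that for $|z|\le C_g$ the loss satisfies $0\le\ell(z)\le C_\ell$, where $C_\ell>0$, and is Lipschitz continuous with constant $L_\ell$. Assume that $r(x)\ge C_r$ for almost every $x$ with respect to the marginal $p(x)$, where $C_r>0$. Assume finally that suprema, over $\mathcal{G}$ and over the class of functions $x\mapsto\ell(g(x))+\frac{1-r(x)}{r(x)}\ell(-g(x))$,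 $g\in\mathcal{G}$, of weighted, possibly centred, sums $\sum_i e_i f(x_i)-b\,\mathbb{E}_{p(x\mid y=+1)}[f]$ are measurable functions of the sample, up to null sets (automatic, for instance, if $\mathcal{G}$ is countable). Then for every $\delta>0$, with probability at least $1-\delta$ over $x_1,\dots,x_n$, $$\sup_{g\in\mathcal{G}}|\widehat R(g)-R(g)|\le 2\pi_+\Big(L_\ell+\frac{L_\ell}{C_r}\Big)\mathfrak{R}_n(\mathcal{G})+\pi_+\Big(C_\ell+\frac{C_\ell}{C_r}\Big)\sqrt{\frac{\ln(2/\delta)}{2n}},$$ where $\mathfrak{R}_n(\mathcal{G})=\mathbb{E}_{x_1,\dots,x_n}\mathbb{E}_{\sigma_1,\dots,\sigma_n}\big[\sup_{g\in\mathcal{G}}\frac1n\sum_{i=1}^n\sigma_i g(x_i)\big]$ is the Rademacher complexity of $\mathcal{G}$, with $x_i$ drawn independently from $p(x\mid y=+1)$ and $\sigma_1,\dots,\sigma_n$ independent and uniform on $\{+1,-1\}$. (For $\delta\geq 2$ the claim is trivial and the square root may be read as $0$.) -/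

import Mathlib

open MeasureTheory ProbabilityTheory

noncomputable section

namespace Pconf

/-- The label space `{+1, -1}` is a finite discrete space, hence standard Borel. -/
instance instStandardBorelLabel : StandardBorelSpace ℤˣ := by
  have : MeasurableSingletonClass ℤˣ := ⟨fun y =>
    ⟨{(y : ℤ)}, MeasurableSet.singleton _, by ext z; simp [Units.ext_iff]⟩⟩
  infer_instance

/-- The joint law of a pattern `x` and a label `y ∈ {+1, -1}` is a measure on `X × ℤˣ`.
The class prior `π₊ = p(y = +1)`. -/
def classPrior {X : Type*} [MeasurableSpace X] (D : Measure (X × ℤˣ)) : ℝ :=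
  D.real (Prod.snd ⁻¹' {1})

/-- The positive class-conditional law `p(x ∣ y = +1)`. -/
def posLaw {X : Type*} [MeasurableSpace X] (D : Measure (X × ℤˣ)) : Measure X :=
  (D[|Prod.snd ⁻¹' {1}]).map Prod.fst

/-- The positive confidence `r(x) = p(y = +1 ∣ x)`, through the regular conditional law of the
label given the pattern. -/
def confidence {X : Type*} [MeasurableSpace X] (D : Measure (X × ℤˣ)) [IsFiniteMeasure D]
    (x : X) : ℝ :=
  (D.condKernel x).real {1}

/-- The classification risk `R(g) = E_{p(x,y)}[ℓ(y g(x))]`. -/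
def risk {X : Type*} [MeasurableSpace X] (D : Measure (X × ℤˣ)) (ℓ : ℝ → ℝ) (g : X → ℝ) : ℝ :=
  ∫ z, ℓ (((z.2 : ℤ) : ℝ) * g z.1) ∂D

/-- The empirical Pconf risk of `g` on the positive-confidence data `(x₁, r₁), …, (xₙ, rₙ)`,
multiplied by the class prior `π`. -/
def empiricalRisk {X : Type*} {n : ℕ} (π : ℝ) (ℓ : ℝ → ℝ) (s : Fin n → X × ℝ) (g : X → ℝ) : ℝ :=
  π * ((n : ℝ)⁻¹ *
    ∑ i, (ℓ (g (s i).1) + (1 - (s i).2) / (s i).2 * ℓ (-g (s i).1)))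

/-- The Rademacher complexity of the class `G` for samples of size `n` drawn from `P`; the
expectation over the `n` Rademacher variables is the average over all sign vectors. -/
def rademacher {X : Type*} [MeasurableSpace X] (P : Measure X) (n : ℕ) (G : Set (X → ℝ)) : ℝ :=
  ∫ x : Fin n → X, ((2 : ℝ) ^ n)⁻¹ * ∑ σ : Fin n → ℤˣ,
    ⨆ g : G, (n : ℝ)⁻¹ * ∑ i, ((σ i : ℤ) : ℝ) * (g : X → ℝ) (x i) ∂(Measure.pi fun _ => P)

/-- The Pconf losses `x ↦ ℓ(g(x)) + (1 - r(x)) / r(x) * ℓ(-g(x))` of the functions `g ∈ G`. -/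
def lossClass {X : Type*} (r : X → ℝ) (ℓ : ℝ → ℝ) (G : Set (X → ℝ)) : Set (X → ℝ) :=
  (fun g x => ℓ (g x) + (1 - r x) / r x * ℓ (-g x)) '' G

/-- Measurability of a (possibly uncountable) class `F` of functions with respect to `P`:
suprema over `F` of weighted sums, possibly centred, are measurable functions of the sample
with respect to the completion of the product law. Every countable class of measurable
functions has this property. -/
def IsMeasurableClass {X : Type*} [MeasurableSpace X] (P : Measure X) (F : Set (X → ℝ)) : Prop :=
  ∀ (m : ℕ) (e : Fin m → ℝ) (b : ℝ),
    AEMeasurable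
      (fun x : Fin m → X => ⨆ f : F, (∑ i, e i * (f : X → ℝ) (x i) - b * ∫ t, (f : X → ℝ) t ∂P))
      (Measure.pi fun _ => P)

end Pconf

end

/-
Conditioning on the pattern turns `R(g)` into the mean of `r(x) ℓ(g(x)) + (1 - r(x)) ℓ(-g(x))` over
the marginal law, and `r` is `π₊` times the density of the positive class-conditional law with
respect to the marginal. Hence `R(g)` is `π₊` times the mean of the Pconf loss under the positive
law, and the claim is a uniform deviation bound for the class of Pconf losses. McDiarmid's
inequality concentrates the one-sided suprema around their means, symmetrization bounds these means
by twice the Rademacher complexity of the Pconf losses, and the contraction principle, the Pconf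
loss being `(L_ℓ + L_ℓ / C_r)`-Lipschitz in `g(x)`, compares this complexity with that of `G`.
-/

namespace Pconf

open scoped NNReal

/-! ### The contraction principle -/

section Contraction

variable {ι : Type*}

lemma bddAbove_range_of_abs_le {f : ι → ℝ} {M : ℝ} (h : ∀ i, |f i| ≤ M) :
    BddAbove (Set.range f) :=
  ⟨M, Set.forall_mem_range.2 fun i => (le_abs_self _).trans (h i)⟩

lemma abs_ciSup_le [Nonempty ι] {f : ι → ℝ} {M : ℝ} (h : ∀ i, |f i| ≤ M) : |⨆ i, f i| ≤ M := by
  have i := Classical.arbitrary ι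
  refine abs_le.2 ⟨?_, ciSup_le fun i => (le_abs_self _).trans (h i)⟩
  exact (abs_le.1 (h i)).1.trans (le_ciSup (bddAbove_range_of_abs_le h) i)

lemma abs_sum_mul_le {κ : Type*} [Fintype κ] (w : κ → ℝ) {u : κ → ℝ} {M : ℝ}
    (hu : ∀ k, |u k| ≤ M) : |∑ k, w k * u k| ≤ (∑ k, |w k|) * M := by
  rw [Finset.sum_mul]
  refine (Finset.abs_sum_le_sum_abs _ _).trans (Finset.sum_le_sum fun k _ => ?_)
  rw [abs_mul]
  exact mul_le_mul_of_nonneg_left (hu k) (abs_nonneg _)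

lemma iSup_add_iSup_sub_le_of_contraction [Nonempty ι] {d a b : ι → ℝ}
    (hba : ∀ i j, |b i - b j| ≤ |a i - a j|)
    (hadd : BddAbove (Set.range fun i => d i + a i))
    (hsub : BddAbove (Set.range fun i => d i - a i)) :
    (⨆ i, (d i + b i)) + ⨆ i, (d i - b i) ≤ (⨆ i, (d i + a i)) + ⨆ i, (d i - a i) := by
  have pair_le (i j) : d i + b i + (d j - b j) ≤ (⨆ i, (d i + a i)) + ⨆ i, (d i - a i) := by
    have hij := (le_abs_self _).trans (hba i j)
    rcases abs_cases (a i - a j) with ⟨ha, -⟩ | ⟨ha, -⟩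
    · linarith [le_ciSup hadd i, le_ciSup hsub j]
    · linarith [le_ciSup hadd j, le_ciSup hsub i]
  refine le_sub_iff_add_le.1 (ciSup_le fun i => le_sub_comm.1 (ciSup_le fun j => ?_))
  linarith [pair_le i j]

lemma sum_signs_succ {n : ℕ} (F : (Fin (n + 1) → ℤˣ) → ℝ) :
    ∑ σ, F σ = ∑ σ : Fin n → ℤˣ, (F (Fin.cons 1 σ) + F (Fin.cons (-1) σ)) := by
  rw [← (Fin.consEquiv fun _ => ℤˣ).sum_comp, Fintype.sum_prod_type, Finset.sum_add_distrib]
  exact Finset.sum_pair (by decide)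

lemma sum_iSup_sign_le_of_contraction [Nonempty ι] {n : ℕ} {a b : ι → Fin n → ℝ} {c : ι → ℝ}
    {K M : ℝ} (hc : ∀ i, |c i| ≤ K) (ha : ∀ i k, |a i k| ≤ M)
    (hba : ∀ i j k, |b i k - b j k| ≤ |a i k - a j k|) :
    ∑ σ : Fin n → ℤˣ, ⨆ i, (c i + ∑ k, ((σ k : ℤ) : ℝ) * b i k) ≤
      ∑ σ : Fin n → ℤˣ, ⨆ i, (c i + ∑ k, ((σ k : ℤ) : ℝ) * a i k) := by
  induction n generalizing c K with
  | zero => simp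
  | succ n ih =>
    have j := Classical.arbitrary ι
    have hb (i) : |b i 0| ≤ M + M + |b j 0| :=
      calc |b i 0| ≤ |b i 0 - b j 0| + |b j 0| := by
            linarith [abs_sub_abs_le_abs_sub (b i 0) (b j 0)]
        _ ≤ |a i 0| + |a j 0| + |b j 0| := by gcongr; exact (hba i j 0).trans (abs_sub _ _)
        _ ≤ M + M + |b j 0| := by gcongr <;> exact ha _ 0
    simp only [sum_signs_succ, Fin.sum_univ_succ, Fin.cons_zero, Fin.cons_succ, Units.val_one,
      Units.val_neg, Int.cast_one, Int.cast_neg, one_mul, neg_mul, ← sub_eq_add_neg, ← add_assoc]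
    calc ∑ σ : Fin n → ℤˣ, ((⨆ i, (c i + b i 0 + ∑ k, ((σ k : ℤ) : ℝ) * b i k.succ)) +
          ⨆ i, (c i + -b i 0 + ∑ k, ((σ k : ℤ) : ℝ) * b i k.succ))
        ≤ ∑ σ : Fin n → ℤˣ, ((⨆ i, (c i + b i 0 + ∑ k, ((σ k : ℤ) : ℝ) * a i k.succ)) +
          ⨆ i, (c i + -b i 0 + ∑ k, ((σ k : ℤ) : ℝ) * a i k.succ)) := by
          simp only [Finset.sum_add_distrib]
          exact add_le_add
            (ih (fun i => (abs_add_le _ _).trans (add_le_add (hc i) (hb i)))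
              (fun i k => ha i k.succ) fun i j k => hba i j k.succ)
            (ih (fun i => (abs_add_le _ _).trans
                (add_le_add (hc i) ((abs_neg (b i 0)).trans_le (hb i))))
              (fun i k => ha i k.succ) fun i j k => hba i j k.succ)
      _ = ∑ σ : Fin n → ℤˣ, ((⨆ i, (c i + ∑ k, ((σ k : ℤ) : ℝ) * a i k.succ + b i 0)) +
          ⨆ i, (c i + ∑ k, ((σ k : ℤ) : ℝ) * a i k.succ - b i 0)) := by
          simp only [add_right_comm (c _), sub_eq_add_neg]
      _ ≤ ∑ σ : Fin n → ℤˣ, ((⨆ i, (c i + ∑ k, ((σ k : ℤ) : ℝ) * a i k.succ + a i 0)) +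
          ⨆ i, (c i + ∑ k, ((σ k : ℤ) : ℝ) * a i k.succ - a i 0)) := by
          refine Finset.sum_le_sum fun σ _ => ?_
          have hd (i) := (abs_add_le _ _).trans
            (add_le_add (hc i) (abs_sum_mul_le (fun k => ((σ k : ℤ) : ℝ)) fun k => ha i k.succ))
          exact iSup_add_iSup_sub_le_of_contraction (fun i j => hba i j 0)
            (bddAbove_range_of_abs_le fun i => (abs_add_le _ _).trans (add_le_add (hd i) (ha i 0)))
            (bddAbove_range_of_abs_le fun i => (abs_sub _ _).trans (add_le_add (hd i) (ha i 0)))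
      _ = _ := by simp only [add_right_comm (c _), sub_eq_add_neg]

end Contraction

/-! ### The bounded differences inequality -/

section BoundedDifferences

/-- Bounded differences: changing the coordinate `k` alone increases, hence (exchanging the two
points) changes, the value of `f` by at most `c k`. -/
def HasBoundedDifferences {ι : Type*} [DecidableEq ι] {X : ι → Type*} (f : (∀ i, X i) → ℝ)
    (c : ι → ℝ≥0) : Prop :=
  ∀ x k y, f (Function.update x k y) ≤ f x + c k

lemma HasBoundedDifferences.le_add_sum {ι : Type*} [Fintype ι] [DecidableEq ι] {X : ι → Type*}
    {f : (∀ i, X i) → ℝ} {c : ι → ℝ≥0} (hf : HasBoundedDifferences f c) (x y : ∀ i, X i) :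
    f y ≤ f x + ∑ k, (c k : ℝ) := by
  suffices h : ∀ s : Finset ι, f (s.piecewise y x) ≤ f x + ∑ k ∈ s, (c k : ℝ) by
    simpa using h Finset.univ
  intro s
  induction s using Finset.induction_on with
  | empty => simp
  | insert k s hk ih =>
    rw [Finset.piecewise_insert, Finset.sum_insert hk]
    linarith [hf (s.piecewise y x) k (y k)]

lemma HasBoundedDifferences.exists_abs_le {ι : Type*} [Finite ι] [DecidableEq ι] {X : ι → Type*}
    [Nonempty (∀ i, X i)] {f : (∀ i, X i) → ℝ} {c : ι → ℝ≥0} (hf : HasBoundedDifferences f c) :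
    ∃ M, ∀ x, |f x| ≤ M := by
  have := Fintype.ofFinite ι
  have x₀ := Classical.arbitrary (∀ i, X i)
  refine ⟨|f x₀| + ∑ k, (c k : ℝ), fun x => abs_le.2 ⟨?_, ?_⟩⟩
  · linarith [hf.le_add_sum x x₀, neg_abs_le (f x₀)]
  · linarith [hf.le_add_sum x₀ x, le_abs_self (f x₀)]

variable {A Y : Type*} [MeasurableSpace A] [MeasurableSpace Y] {P : Measure A} {Q : Measure Y}

-- The Bochner integral is `0` on the nonmeasurable sections of `F`, so the comparison of any two
-- sections is available for lower integrals only.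
lemma exists_partial_integral [IsProbabilityMeasure P] [IsFiniteMeasure Q] {F : A × Y → ℝ} {M : ℝ}
    (hF : AEMeasurable F (P.prod Q)) (hM : ∀ z, |F z| ≤ M) :
    ∃ h : Y → ℝ, AEMeasurable h Q ∧ (∀ᵐ y ∂Q, h y = ∫ a, F (a, y) ∂P) ∧
      ∀ (y y' : Y) (c : ℝ≥0), (∀ a, F (a, y') ≤ F (a, y) + c) → h y' ≤ h y + c := by
  have hnonneg (z) : 0 ≤ F z + M := by linarith [(abs_le.1 (hM z)).1]
  set I : Y → ENNReal := fun y => ∫⁻ a, ENNReal.ofReal (F (a, y) + M) ∂P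
  have hI (y) : I y ≠ ⊤ := by
    refine ne_top_of_le_ne_top (b := ENNReal.ofReal (M + M)) ENNReal.ofReal_ne_top ?_
    refine (lintegral_mono (g := fun _ => ENNReal.ofReal (M + M)) fun a =>
      ENNReal.ofReal_le_ofReal ?_).trans (by simp)
    exact add_le_add_left (abs_le.1 (hM _)).2 M
  refine ⟨fun y => (I y).toReal - M, ?_, ?_, fun y y' c hc => ?_⟩
  · exact ((hF.add_const M).ennreal_ofReal.lintegral_prod_left').ennreal_toReal.sub_const M
  · have hFi : Integrable F (P.prod Q) :=
      .of_bound hF.aestronglyMeasurable M (.of_forall hM)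
    filter_upwards [hFi.prod_left_ae] with y hy
    rw [← integral_eq_lintegral_of_nonneg_ae (.of_forall fun a => hnonneg _)
      (hy.aestronglyMeasurable.add_const M), integral_add hy (integrable_const M)]
    simp
  · have hle : I y' ≤ I y + c := calc
      I y' ≤ ∫⁻ a, (ENNReal.ofReal (F (a, y) + M) + c) ∂P := lintegral_mono fun a => by
        rw [← ENNReal.ofReal_coe_nnreal, ← ENNReal.ofReal_add (hnonneg _) c.coe_nonneg]
        exact ENNReal.ofReal_le_ofReal (by linarith [hc a])
      _ = I y + c := by rw [lintegral_add_right _ measurable_const]; simp [I]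
    have := ENNReal.toReal_mono (ENNReal.add_ne_top.2 ⟨hI y, ENNReal.coe_ne_top⟩) hle
    rw [ENNReal.toReal_add (hI y) ENNReal.coe_ne_top, ENNReal.coe_toReal] at this
    linarith

lemma hasSubgaussianMGF_prod [SFinite P] [SFinite Q] {F : A × Y → ℝ} {h : Y → ℝ} {c d : ℝ≥0}
    (hF : AEMeasurable F (P.prod Q))
    (hFh : ∀ᵐ y ∂Q, HasSubgaussianMGF (fun a => F (a, y) - h y) c P)
    (hh : HasSubgaussianMGF h d Q) : HasSubgaussianMGF F (c + d) (P.prod Q) := by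
  have exp_split (t y a) :
      Real.exp (t * F (a, y)) = Real.exp (t * h y) * Real.exp (t * (F (a, y) - h y)) := by
    rw [← Real.exp_add]; ring_nf
  have section_le (t) : ∀ᵐ y ∂Q, ∫ a, Real.exp (t * F (a, y)) ∂P ≤
      Real.exp (t * h y) * Real.exp (c * t ^ 2 / 2) := by
    filter_upwards [hFh] with y hy
    simp only [exp_split, integral_const_mul]
    exact mul_le_mul_of_nonneg_left (hy.mgf_le t) (Real.exp_nonneg _)
  have hbound (t) := (hh.integrable_exp_mul t).mul_const (Real.exp (c * t ^ 2 / 2))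
  have hint (t) : Integrable (fun z => Real.exp (t * F z)) (P.prod Q) := by
    have hmeas := (hF.const_mul t).exp.aestronglyMeasurable
    refine (integrable_prod_iff' hmeas).2 ⟨?_, (hbound t).mono' ?_ ?_⟩
    · filter_upwards [hFh] with y hy
      simp only [exp_split]
      exact (hy.integrable_exp_mul t).const_mul _
    · exact hmeas.norm.prod_swap.integral_prod_right'
    · filter_upwards [section_le t] with y hy
      have hnonneg : 0 ≤ ∫ a, Real.exp (t * F (a, y)) ∂P := integral_nonneg fun a => by positivity
      simpa only [Real.norm_eq_abs, Real.abs_exp, abs_of_nonneg hnonneg] using hy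
  refine ⟨hint, fun t => ?_⟩
  calc mgf F (P.prod Q) t = ∫ y, ∫ a, Real.exp (t * F (a, y)) ∂P ∂Q :=
        integral_prod_symm _ (hint t)
    _ ≤ ∫ y, Real.exp (t * h y) * Real.exp (c * t ^ 2 / 2) ∂Q :=
        integral_mono_ae (hint t).integral_prod_right (hbound t) (section_le t)
    _ = mgf h Q t * Real.exp (c * t ^ 2 / 2) := integral_mul_const _ _
    _ ≤ Real.exp (d * t ^ 2 / 2) * Real.exp (c * t ^ 2 / 2) := by gcongr; exact hh.mgf_le t
    _ = Real.exp ((c + d : ℝ≥0) * t ^ 2 / 2) := by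
        rw [← Real.exp_add]; push_cast; ring_nf

lemma hasSubgaussianMGF_of_oscillation_le [IsProbabilityMeasure P] {f : A → ℝ}
    (hf : AEMeasurable f P) {c : ℝ≥0} (hc : ∀ a a', f a ≤ f a' + c) :
    HasSubgaussianMGF (fun a => f a - ∫ a, f a ∂P) ((c / 2) ^ 2) P := by
  have : Nonempty A := P.nonempty_of_neZero
  have hbdd : BddBelow (Set.range f) :=
    ⟨f (Classical.arbitrary A) - c, Set.forall_mem_range.2 fun a => by
      linarith [hc (Classical.arbitrary A) a]⟩
  have := hasSubgaussianMGF_of_mem_Icc (a := ⨅ a, f a) (b := (⨅ a, f a) + c) hf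
    (.of_forall fun a => ⟨ciInf_le hbdd a,
      sub_le_iff_le_add.1 (le_ciInf fun a' => sub_le_iff_le_add.2 (hc a a'))⟩)
  simpa using this

/-- **McDiarmid's inequality** in moment generating function form. -/
theorem HasBoundedDifferences.hasSubgaussianMGF {n : ℕ} {X : Fin n → Type*}
    [∀ k, MeasurableSpace (X k)] {P : ∀ k, Measure (X k)} [∀ k, IsProbabilityMeasure (P k)]
    {f : (∀ k, X k) → ℝ} {c : Fin n → ℝ≥0} (hc : HasBoundedDifferences f c)
    (hf : AEMeasurable f (Measure.pi P)) :
    HasSubgaussianMGF (fun x => f x - ∫ x, f x ∂Measure.pi P) (∑ k, (c k / 2) ^ 2)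
      (Measure.pi P) := by
  induction n with
  | zero =>
    have hconst (x) : f x - ∫ x, f x ∂Measure.pi P = 0 := by
      simp [Subsingleton.elim _ x]
    simp [hconst]
  | succ n ih =>
    let e : (∀ k, X k) ≃ᵐ X 0 × (∀ k : Fin n, X k.succ) := MeasurableEquiv.piFinSuccAbove X 0
    have e_symm (a y) : e.symm (a, y) = Fin.cons a y := Fin.insertNth_zero a y
    set Q : Measure (∀ k : Fin n, X k.succ) := Measure.pi fun k => P k.succ
    have he : MeasurePreserving e (Measure.pi P) ((P 0).prod Q) :=
      measurePreserving_piFinSuccAbove P 0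
    have hF : AEMeasurable (f ∘ e.symm) ((P 0).prod Q) :=
      hf.comp_quasiMeasurePreserving (he.symm e).quasiMeasurePreserving
    have := (Measure.pi P).nonempty_of_neZero
    obtain ⟨M, hM⟩ := hc.exists_abs_le
    have hFi : Integrable (f ∘ e.symm) ((P 0).prod Q) :=
      .of_bound hF.aestronglyMeasurable M (.of_forall fun z => hM (e.symm z))
    obtain ⟨h, hh, hfh, h_le⟩ := exists_partial_integral hF fun z => hM (e.symm z)
    have mean_h : ∫ y, h y ∂Q = ∫ x, f x ∂Measure.pi P := by
      rw [integral_congr_ae hfh, ← integral_prod_symm _ hFi]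
      exact (he.symm e).integral_comp' f
    have hch : HasBoundedDifferences h fun k => c k.succ := fun y k v =>
      h_le _ _ _ fun a => by
        simpa only [Function.comp_apply, e_symm, Fin.cons_update] using hc (e.symm (a, y)) k.succ v
    have hsub : ∀ᵐ y ∂Q, HasSubgaussianMGF
        (fun a => f (e.symm (a, y)) - (∫ x, f x ∂Measure.pi P) - (h y - ∫ y, h y ∂Q))
        ((c 0 / 2) ^ 2) (P 0) := by
      filter_upwards [hfh, hFi.prod_left_ae] with y hy hyi
      have hosc (a a') : f (e.symm (a, y)) ≤ f (e.symm (a', y)) + c 0 := by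
        simpa only [e_symm, Fin.update_cons_zero] using hc (e.symm (a', y)) 0 a
      simpa [hy, mean_h] using hasSubgaussianMGF_of_oscillation_le hyi.aemeasurable hosc
    have hprod := hasSubgaussianMGF_prod (hF.sub_const _) hsub (ih hch hh)
    rw [Fin.sum_univ_succ]
    refine (HasSubgaussianMGF.of_map he.measurable.aemeasurable
      (he.map_eq.symm ▸ hprod)).congr (.of_forall fun x => ?_)
    exact congrArg (fun y => f y - ∫ x, f x ∂Measure.pi P) (e.symm_apply_apply x)

end BoundedDifferences

/-! ### Symmetrization -/

section Symmetrization

variable {X : Type*} [MeasurableSpace X] {P : Measure X} {F : Set (X → ℝ)} {M : ℝ}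
  {κ κ' : Type*} [Fintype κ] [Fintype κ']

/-- The supremum over `f ∈ F` of the weighted sum `∑ k, w k * f (x k)`, centred by `b` times the
mean of `f`. All deviations and Rademacher averages of `F` have this form; arbitrary finite index
types `κ` allow a sample and its ghost copy to be treated as one sample indexed by `κ ⊕ κ`. -/
noncomputable def supSum (P : Measure X) (F : Set (X → ℝ)) (w : κ → ℝ) (b : ℝ) (x : κ → X) : ℝ :=
  ⨆ f : F, (∑ k, w k * (f : X → ℝ) (x k) - b * ∫ t, (f : X → ℝ) t ∂P)

lemma supSum_comp_equiv (u : κ' ≃ κ) (w : κ → ℝ) (b : ℝ) (x : κ → X) :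
    supSum P F (w ∘ u) b (x ∘ u) = supSum P F w b x :=
  iSup_congr fun f => congrArg (· - b * ∫ t, (f : X → ℝ) t ∂P)
    (u.sum_comp fun k => w k * (f : X → ℝ) (x k))

lemma measurePreserving_comp_injective (P : Measure X) [IsProbabilityMeasure P] {u : κ' → κ}
    (hu : u.Injective) :
    MeasurePreserving (fun x : κ → X => x ∘ u) (Measure.pi fun _ => P) (Measure.pi fun _ => P) := by
  have hindep : iIndepFun (fun (k : κ) (x : κ → X) => x k) (Measure.pi fun _ => P) :=
    iIndepFun_pi (X := fun _ => id) fun _ => aemeasurable_id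
  have hmap := (iIndepFun_iff_map_fun_eq_pi_map
    fun i => (measurable_pi_apply (u i)).aemeasurable).1 (hindep.precomp hu)
  refine ⟨measurable_pi_lambda _ fun i => measurable_pi_apply (u i), hmap.trans ?_⟩
  congr 1
  ext1 i
  exact (measurePreserving_eval (fun _ : κ => P) (u i)).map_eq

variable [IsProbabilityMeasure P]

lemma abs_integral_le {f : X → ℝ} (hM : ∀ x, |f x| ≤ M) : |∫ x, f x ∂P| ≤ M := by
  simpa using norm_integral_le_of_norm_le_const (μ := P) (f := f) (.of_forall hM)

lemma abs_sum_sub_mul_integral_le {f : X → ℝ} (hM : ∀ x, |f x| ≤ M) (w : κ → ℝ) (b : ℝ)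
    (x : κ → X) : |∑ k, w k * f (x k) - b * ∫ t, f t ∂P| ≤ (∑ k, |w k| + |b|) * M :=
  calc |∑ k, w k * f (x k) - b * ∫ t, f t ∂P|
      ≤ |∑ k, w k * f (x k)| + |b| * |∫ t, f t ∂P| := by rw [← abs_mul]; exact abs_sub _ _
    _ ≤ (∑ k, |w k|) * M + |b| * M := by
        gcongr
        · exact abs_sum_mul_le w fun k => hM (x k)
        · exact abs_integral_le hM
    _ = (∑ k, |w k| + |b|) * M := by ring

lemma le_supSum (hM : ∀ f ∈ F, ∀ x, |f x| ≤ M) {f : X → ℝ} (hf : f ∈ F) (w : κ → ℝ) (b : ℝ)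
    (x : κ → X) : ∑ k, w k * f (x k) - b * ∫ t, f t ∂P ≤ supSum P F w b x :=
  le_ciSup (f := fun f : F => ∑ k, w k * (f : X → ℝ) (x k) - b * ∫ t, (f : X → ℝ) t ∂P)
    (bddAbove_range_of_abs_le fun f => abs_sum_sub_mul_integral_le (hM f f.2) w b x) ⟨f, hf⟩

lemma IsMeasurableClass.aemeasurable_supSum (hF : IsMeasurableClass P F) (w : κ → ℝ) (b : ℝ) :
    AEMeasurable (supSum P F w b) (Measure.pi fun _ => P) := by
  have u := (Fintype.equivFin κ).symm
  refine ((hF _ (w ∘ u) b).comp_quasiMeasurePreserving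
    (measurePreserving_comp_injective P u.injective).quasiMeasurePreserving).congr ?_
  exact .of_forall (supSum_comp_equiv u w b)

lemma IsMeasurableClass.integral_supSum_comp (hF : IsMeasurableClass P F) {u : κ' → κ}
    (hu : u.Injective) (w : κ' → ℝ) (b : ℝ) :
    ∫ z : κ → X, supSum P F w b (z ∘ u) ∂(Measure.pi fun _ => P) =
      ∫ x, supSum P F w b x ∂(Measure.pi fun _ => P) := by
  have hmp := measurePreserving_comp_injective P hu
  rw [← hmp.map_eq, integral_map hmp.aemeasurable]
  rw [hmp.map_eq]
  exact (hF.aemeasurable_supSum w b).aestronglyMeasurable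

lemma IsMeasurableClass.integral_supSum_comp_equiv (hF : IsMeasurableClass P F) (u : κ' ≃ κ)
    (w : κ → ℝ) (b : ℝ) :
    ∫ x, supSum P F (w ∘ u) b x ∂(Measure.pi fun _ => P) =
      ∫ x, supSum P F w b x ∂(Measure.pi fun _ => P) := by
  simp_rw [← hF.integral_supSum_comp u.injective, supSum_comp_equiv]

variable [Nonempty F]

lemma abs_supSum_le (hM : ∀ f ∈ F, ∀ x, |f x| ≤ M) (w : κ → ℝ) (b : ℝ) (x : κ → X) :
    |supSum P F w b x| ≤ (∑ k, |w k| + |b|) * M :=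
  abs_ciSup_le fun f => abs_sum_sub_mul_integral_le (hM f f.2) w b x

lemma supSum_sumElim_le (hM : ∀ f ∈ F, ∀ x, |f x| ≤ M) (v : κ → ℝ) (w : κ' → ℝ) (b c : ℝ)
    (z : κ ⊕ κ' → X) :
    supSum P F (Sum.elim v w) (b + c) z ≤
      supSum P F v b (z ∘ Sum.inl) + supSum P F w c (z ∘ Sum.inr) := by
  refine ciSup_le fun f => ?_
  simp only [Fintype.sum_sum_type, Sum.elim_inl, Sum.elim_inr, add_mul, add_sub_add_comm]
  exact add_le_add (le_supSum hM f.2 v b (z ∘ Sum.inl)) (le_supSum hM f.2 w c (z ∘ Sum.inr))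

lemma IsMeasurableClass.integrable_supSum (hF : IsMeasurableClass P F)
    (hM : ∀ f ∈ F, ∀ x, |f x| ≤ M) (w : κ → ℝ) (b : ℝ) :
    Integrable (supSum P F w b) (Measure.pi fun _ => P) :=
  .of_bound (hF.aemeasurable_supSum w b).aestronglyMeasurable _ (.of_forall (abs_supSum_le hM w b))

lemma IsMeasurableClass.integral_supSum_sumElim_le (hF : IsMeasurableClass P F)
    (hM : ∀ f ∈ F, ∀ x, |f x| ≤ M) (v : κ → ℝ) (w : κ' → ℝ) (b c : ℝ) :
    ∫ z, supSum P F (Sum.elim v w) (b + c) z ∂(Measure.pi fun _ => P) ≤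
      ∫ x, supSum P F v b x ∂(Measure.pi fun _ => P) +
        ∫ x, supSum P F w c x ∂(Measure.pi fun _ => P) := by
  have hl : Integrable (fun z : κ ⊕ κ' → X => supSum P F v b (z ∘ Sum.inl))
      (Measure.pi fun _ => P) :=
    (measurePreserving_comp_injective P Sum.inl_injective).integrable_comp_of_integrable
      (hF.integrable_supSum hM v b)
  have hr : Integrable (fun z : κ ⊕ κ' → X => supSum P F w c (z ∘ Sum.inr))
      (Measure.pi fun _ => P) :=
    (measurePreserving_comp_injective P Sum.inr_injective).integrable_comp_of_integrable
      (hF.integrable_supSum hM w c)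
  rw [← hF.integral_supSum_comp (κ := κ ⊕ κ') Sum.inl_injective,
    ← hF.integral_supSum_comp (κ := κ ⊕ κ') Sum.inr_injective, ← integral_add hl hr]
  exact integral_mono (hF.integrable_supSum hM _ _) (hl.add hr) (supSum_sumElim_le hM v w b c)

lemma integral_sum_mul_eval {f : X → ℝ} (hf : Integrable f P) (w : κ → ℝ) :
    ∫ y : κ → X, ∑ k, w k * f (y k) ∂(Measure.pi fun _ => P) = (∑ k, w k) * ∫ t, f t ∂P := by
  rw [integral_finsetSum _ fun k _ => ?_, Finset.sum_mul]
  · refine Finset.sum_congr rfl fun k _ => ?_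
    rw [integral_const_mul, integral_comp_eval hf.aestronglyMeasurable]
  · exact (integrable_comp_eval hf).const_mul _

lemma IsMeasurableClass.integral_supSum_le_sumElim_neg (hF : IsMeasurableClass P F)
    (hm : ∀ f ∈ F, AEMeasurable f P) (hM : ∀ f ∈ F, ∀ x, |f x| ≤ M) (w : κ → ℝ) :
    ∫ x, supSum P F w (∑ k, w k) x ∂(Measure.pi fun _ => P) ≤
      ∫ z, supSum P F (Sum.elim w (-w)) 0 z ∂(Measure.pi fun _ => P) := by
  set Q : Measure (κ → X) := Measure.pi fun _ => P
  let e : (κ ⊕ κ → X) ≃ᵐ (κ → X) × (κ → X) :=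
    MeasurableEquiv.sumPiEquivProdPi fun _ : κ ⊕ κ => X
  have he : MeasurePreserving e.symm (Q.prod Q) (Measure.pi fun _ => P) :=
    measurePreserving_sumPiEquivProdPi_symm fun _ => P
  have hint : Integrable (fun z => supSum P F (Sum.elim w (-w)) 0 (e.symm z)) (Q.prod Q) :=
    he.integrable_comp_of_integrable (hF.integrable_supSum hM _ _)
  rw [← he.integral_comp', integral_prod _ hint]
  refine integral_mono_ae (hF.integrable_supSum hM _ _) hint.integral_prod_left ?_
  filter_upwards [hint.prod_right_ae] with x hx
  refine ciSup_le fun f => ?_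
  have hf : Integrable (f : X → ℝ) P :=
    .of_bound (hm f f.2).aestronglyMeasurable M (.of_forall (hM f f.2))
  have hsum : Integrable (fun y : κ → X => ∑ k, w k * (f : X → ℝ) (y k)) Q :=
    integrable_finsetSum _ fun k _ => (integrable_comp_eval hf).const_mul _
  calc ∑ k, w k * (f : X → ℝ) (x k) - (∑ k, w k) * ∫ t, (f : X → ℝ) t ∂P
      = ∫ y, (∑ k, w k * (f : X → ℝ) (x k) - ∑ k, w k * (f : X → ℝ) (y k)) ∂Q := by
        rw [integral_sub (integrable_const _) hsum, integral_sum_mul_eval hf]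
        simp
    _ ≤ ∫ y, supSum P F (Sum.elim w (-w)) 0 (e.symm (x, y)) ∂Q := by
        refine integral_mono ((integrable_const _).sub hsum) hx fun y => ?_
        refine (le_of_eq ?_).trans (le_supSum hM f.2 (Sum.elim w (-w)) 0 (e.symm (x, y)))
        simp only [Fintype.sum_sum_type, Sum.elim_inl, Sum.elim_inr, Pi.neg_apply, neg_mul,
          Finset.sum_neg_distrib, zero_mul, sub_zero, ← sub_eq_add_neg]
        rfl

-- The law of the sample and its ghost copy is invariant under exchanging the two copies of the
-- points with `σ k = -1`.
lemma IsMeasurableClass.integral_supSum_sumElim_neg_le (hF : IsMeasurableClass P F)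
    (hM : ∀ f ∈ F, ∀ x, |f x| ≤ M) (w : κ → ℝ) (σ : κ → ℤˣ) :
    ∫ z, supSum P F (Sum.elim w (-w)) 0 z ∂(Measure.pi fun _ => P) ≤
      ∫ x, supSum P F (fun k => ((σ k : ℤ) : ℝ) * w k) 0 x ∂(Measure.pi fun _ => P) +
        ∫ x, supSum P F (fun k => (((-σ) k : ℤ) : ℝ) * w k) 0 x ∂(Measure.pi fun _ => P) := by
  let swap : κ ⊕ κ → κ ⊕ κ :=
    Sum.elim (fun k => if σ k = 1 then .inl k else .inr k)
      (fun k => if σ k = 1 then .inr k else .inl k)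
  have hswap : Function.Involutive swap := by
    rintro (k | k) <;> by_cases hk : σ k = 1 <;> simp [swap, hk]
  have hw : Sum.elim w (-w) ∘ hswap.toPerm =
      Sum.elim (fun k => ((σ k : ℤ) : ℝ) * w k) (fun k => (((-σ) k : ℤ) : ℝ) * w k) := by
    ext (k | k) <;> rcases Int.units_eq_one_or (σ k) with hk | hk <;> simp [swap, hk]
  rw [← hF.integral_supSum_comp_equiv hswap.toPerm, hw]
  simpa only [add_zero] using hF.integral_supSum_sumElim_le hM _ _ 0 0

lemma IsMeasurableClass.integral_supSum_le_average (hF : IsMeasurableClass P F)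
    (hm : ∀ f ∈ F, AEMeasurable f P) (hM : ∀ f ∈ F, ∀ x, |f x| ≤ M) {n : ℕ} (w : Fin n → ℝ) :
    ∫ x, supSum P F w (∑ k, w k) x ∂(Measure.pi fun _ => P) ≤
      2 * (((2 : ℝ) ^ n)⁻¹ * ∑ σ : Fin n → ℤˣ,
        ∫ x, supSum P F (fun k => ((σ k : ℤ) : ℝ) * w k) 0 x ∂(Measure.pi fun _ => P)) := by
  set E := ∫ x, supSum P F w (∑ k, w k) x ∂(Measure.pi fun _ => P)
  set I : (Fin n → ℤˣ) → ℝ := fun σ =>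
    ∫ x, supSum P F (fun k => ((σ k : ℤ) : ℝ) * w k) 0 x ∂(Measure.pi fun _ => P)
  have hE (σ) : E ≤ I σ + I (-σ) :=
    (hF.integral_supSum_le_sumElim_neg hm hM w).trans (hF.integral_supSum_sumElim_neg_le hM w σ)
  have hneg : ∑ σ, I (-σ) = ∑ σ, I σ := Equiv.sum_comp (Equiv.neg _) I
  calc E = ((2 : ℝ) ^ n)⁻¹ * ∑ _σ : Fin n → ℤˣ, E := by simp
    _ ≤ ((2 : ℝ) ^ n)⁻¹ * ∑ σ, (I σ + I (-σ)) := by gcongr with σ; exact hE σ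
    _ = 2 * (((2 : ℝ) ^ n)⁻¹ * ∑ σ, I σ) := by rw [Finset.sum_add_distrib, hneg]; ring

lemma IsMeasurableClass.rademacher_eq (hF : IsMeasurableClass P F)
    (hM : ∀ f ∈ F, ∀ x, |f x| ≤ M) (n : ℕ) :
    rademacher P n F = ((2 : ℝ) ^ n)⁻¹ * ∑ σ : Fin n → ℤˣ,
      ∫ x, supSum P F (fun k => ((σ k : ℤ) : ℝ) * (n : ℝ)⁻¹) 0 x ∂(Measure.pi fun _ => P) := by
  rw [← integral_finsetSum _ fun σ _ => hF.integrable_supSum hM _ _, ← integral_const_mul]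
  simp only [rademacher, supSum, Finset.mul_sum, zero_mul, sub_zero, mul_assoc, mul_left_comm]

lemma IsMeasurableClass.integral_supSum_le_rademacher (hF : IsMeasurableClass P F)
    (hm : ∀ f ∈ F, AEMeasurable f P) (hM : ∀ f ∈ F, ∀ x, |f x| ≤ M) {n : ℕ} (hn : n ≠ 0)
    (s : ℤˣ) :
    ∫ x, supSum P F (fun _ : Fin n => ((s : ℤ) : ℝ) * (n : ℝ)⁻¹) ((s : ℤ) : ℝ) x
        ∂(Measure.pi fun _ => P) ≤ 2 * rademacher P n F := by
  have hmass : ∑ _k : Fin n, ((s : ℤ) : ℝ) * (n : ℝ)⁻¹ = ((s : ℤ) : ℝ) := by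
    simp [mul_left_comm, hn]
  have hsymm := hF.integral_supSum_le_average hm hM fun _ : Fin n => ((s : ℤ) : ℝ) * (n : ℝ)⁻¹
  rw [hmass] at hsymm
  rw [hF.rademacher_eq hM, ← Equiv.sum_comp (Equiv.mulRight fun _ : Fin n => s)]
  simpa only [Equiv.coe_mulRight, Pi.mul_apply, Units.val_mul, Int.cast_mul, mul_assoc] using hsymm

end Symmetrization

section RademacherContraction

variable {X : Type*} [MeasurableSpace X] {P : Measure X}
  {G : Set (X → ℝ)} [Nonempty G] {Φ : (X → ℝ) → X → ℝ} {K L M : ℝ}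

lemma sum_supSum_image_le (hL : 0 ≤ L) (hK : ∀ g ∈ G, ∀ x, |g x| ≤ K)
    (hΦ : ∀ f ∈ G, ∀ g ∈ G, ∀ x, |Φ f x - Φ g x| ≤ L * |f x - g x|) {n : ℕ} (w : Fin n → ℝ)
    (x : Fin n → X) :
    ∑ σ : Fin n → ℤˣ, supSum P (Φ '' G) (fun k => ((σ k : ℤ) : ℝ) * w k) 0 x ≤
      L * ∑ σ : Fin n → ℤˣ, supSum P G (fun k => ((σ k : ℤ) : ℝ) * w k) 0 x := by
  have hbound (g : G) (k) : |L * (w k * (g : X → ℝ) (x k))| ≤ L * ((∑ k, |w k|) * K) := by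
    rw [abs_mul, abs_mul, abs_of_nonneg hL]
    gcongr
    · exact Finset.single_le_sum (f := fun k => |w k|) (fun _ _ => abs_nonneg _)
        (Finset.mem_univ k)
    · exact hK g g.2 (x k)
  have hcontr (f g : G) (k) : |w k * Φ f (x k) - w k * Φ g (x k)| ≤
      |L * (w k * (f : X → ℝ) (x k)) - L * (w k * (g : X → ℝ) (x k))| := by
    simp only [← mul_sub, abs_mul, abs_of_nonneg hL, mul_left_comm L]
    gcongr
    exact hΦ f f.2 g g.2 (x k)
  have h := sum_iSup_sign_le_of_contraction (c := 0) (K := 0) (by simp) hbound hcontr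
  simp only [Pi.zero_apply, zero_add] at h
  simp only [supSum, zero_mul, sub_zero, mul_assoc, Finset.mul_sum,
    Real.mul_iSup_of_nonneg hL, mul_left_comm L] at h ⊢
  simpa only [← (Set.imageFactorization_surjective (f := Φ) (s := G)).iSup_comp,
    Set.imageFactorization] using h

lemma rademacher_image_le [IsProbabilityMeasure P] (hL : 0 ≤ L) (hG : IsMeasurableClass P G)
    (hK : ∀ g ∈ G, ∀ x, |g x| ≤ K) (hΦG : IsMeasurableClass P (Φ '' G))
    (hM : ∀ g ∈ G, ∀ x, |Φ g x| ≤ M)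
    (hΦ : ∀ f ∈ G, ∀ g ∈ G, ∀ x, |Φ f x - Φ g x| ≤ L * |f x - g x|) (n : ℕ) :
    rademacher P n (Φ '' G) ≤ L * rademacher P n G := by
  rw [hΦG.rademacher_eq (Set.forall_mem_image.2 hM), hG.rademacher_eq hK, mul_left_comm,
    ← integral_finsetSum _ fun σ _ => hΦG.integrable_supSum (Set.forall_mem_image.2 hM) _ _,
    ← integral_finsetSum _ fun σ _ => hG.integrable_supSum hK _ _,
    ← integral_const_mul L]
  gcongr
  · exact integrable_finsetSum _ fun σ _ => hΦG.integrable_supSum (Set.forall_mem_image.2 hM) _ _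
  · exact (integrable_finsetSum _ fun σ _ => hG.integrable_supSum hK _ _).const_mul _
  · exact sum_supSum_image_le hL hK hΦ _

end RademacherContraction

/-! ### Uniform deviations -/

section Deviation

variable {X : Type*} {F : Set (X → ℝ)} {a b : ℝ}

lemma abs_le_max_of_mem_Icc (hab : ∀ f ∈ F, ∀ x, f x ∈ Set.Icc a b) :
    ∀ f ∈ F, ∀ x, |f x| ≤ max |a| |b| :=
  fun f hf x => abs_le_max_abs_abs (hab f hf x).1 (hab f hf x).2

variable [MeasurableSpace X] {P : Measure X} [IsProbabilityMeasure P]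

lemma abs_average_sub_integral_le {M t : ℝ} (hM : ∀ f ∈ F, ∀ x, |f x| ≤ M) {n : ℕ}
    {x : Fin n → X}
    (ht : ∀ s : ℤˣ, supSum P F (fun _ => ((s : ℤ) : ℝ) * (n : ℝ)⁻¹) ((s : ℤ) : ℝ) x ≤ t)
    {f : X → ℝ} (hf : f ∈ F) : |(n : ℝ)⁻¹ * ∑ k, f (x k) - ∫ t, f t ∂P| ≤ t := by
  have signed_le (s : ℤˣ) : ((s : ℤ) : ℝ) * ((n : ℝ)⁻¹ * ∑ k, f (x k) - ∫ t, f t ∂P) ≤ t := by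
    rw [mul_sub, ← mul_assoc, Finset.mul_sum]
    exact (le_supSum hM hf _ _ x).trans (ht s)
  exact abs_le'.2 ⟨by simpa using signed_le 1, by simpa using signed_le (-1)⟩

lemma hasBoundedDifferences_supSum [Nonempty F] {κ : Type*} [Fintype κ] [DecidableEq κ]
    (hab : ∀ f ∈ F, ∀ x, f x ∈ Set.Icc a b) (w : κ → ℝ) (β : ℝ) :
    HasBoundedDifferences (supSum P F w β) fun k => ‖w k‖₊ * ‖b - a‖₊ := by
  intro x k y
  refine ciSup_le fun ⟨f, hf⟩ => ?_
  have hdiff : ∑ j, w j * f (Function.update x k y j) - ∑ j, w j * f (x j) =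
      w k * (f y - f (x k)) := by
    rw [← Finset.sum_sub_distrib, Fintype.sum_eq_single k fun j hj => by simp [hj],
      Function.update_self, mul_sub]
  have hosc : |f y - f (x k)| ≤ |b - a| :=
    (Real.dist_le_of_mem_Icc (hab f hf y) (hab f hf (x k))).trans (le_abs_self _)
  have hle := le_supSum (P := P) (abs_le_max_of_mem_Icc hab) hf w β x
  calc ∑ j, w j * f (Function.update x k y j) - β * ∫ t, f t ∂P
      = ∑ j, w j * f (x j) - β * ∫ t, f t ∂P + w k * (f y - f (x k)) := by linarith
    _ ≤ supSum P F w β x + |w k| * |b - a| := by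
        refine add_le_add hle ((le_abs_self _).trans ?_)
        rw [abs_mul]
        exact mul_le_mul_of_nonneg_left hosc (abs_nonneg _)

lemma IsMeasurableClass.measureReal_supSum_ge_le [Nonempty F] (hF : IsMeasurableClass P F)
    (hm : ∀ f ∈ F, AEMeasurable f P) (hab : ∀ f ∈ F, ∀ x, f x ∈ Set.Icc a b) (h : a < b) {n : ℕ}
    (hn : n ≠ 0) (s : ℤˣ) {η : ℝ} (hη : 0 < η) :
    (Measure.pi fun _ : Fin n => P).real
        {x | 2 * rademacher P n F + (b - a) * √(Real.log η⁻¹ / (2 * n)) ≤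
          supSum P F (fun _ => ((s : ℤ) : ℝ) * (n : ℝ)⁻¹) ((s : ℤ) : ℝ) x} ≤ η := by
  rcases le_or_gt 1 η with hη1 | hη1
  · exact measureReal_le_one.trans hη1
  set w : Fin n → ℝ := fun _ => ((s : ℤ) : ℝ) * (n : ℝ)⁻¹
  set ε := (b - a) * √(Real.log η⁻¹ / (2 * n))
  have hlog : 0 ≤ Real.log η⁻¹ := Real.log_nonneg (one_le_inv_iff₀.2 ⟨hη, hη1.le⟩)
  have hε : 0 ≤ ε := mul_nonneg (sub_nonneg.2 h.le) (Real.sqrt_nonneg _)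
  have hε_sq : ε ^ 2 = (b - a) ^ 2 * (Real.log η⁻¹ / (2 * n)) := by
    rw [mul_pow, Real.sq_sqrt (by positivity)]
  have hw (k) : |w k| = (n : ℝ)⁻¹ := by
    rcases Int.units_eq_one_or s with hs | hs <;> simp [w, hs]
  have variance : ((∑ k, (‖w k‖₊ * ‖b - a‖₊ / 2) ^ 2 : ℝ≥0) : ℝ) = (b - a) ^ 2 / (4 * n) := by
    push_cast
    simp only [Real.norm_eq_abs, hw, div_pow, mul_pow, sq_abs, Finset.sum_const, Finset.card_univ,
      Fintype.card_fin, nsmul_eq_mul]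
    field_simp
    norm_num
  have mean := hF.integral_supSum_le_rademacher hm (abs_le_max_of_mem_Icc hab) hn s
  have subgaussian :=
    (hasBoundedDifferences_supSum hab w s).hasSubgaussianMGF (hF.aemeasurable_supSum w s)
  calc (Measure.pi fun _ : Fin n => P).real {x | 2 * rademacher P n F + ε ≤ supSum P F w s x}
      ≤ (Measure.pi fun _ : Fin n => P).real
        {x | ε ≤ supSum P F w s x - ∫ x, supSum P F w s x ∂Measure.pi fun _ => P} :=
      measureReal_mono fun x hx => le_sub_iff_add_le'.2 ((add_le_add_left mean ε).trans hx)
    _ ≤ Real.exp (-ε ^ 2 / (2 * ((b - a) ^ 2 / (4 * n)))) :=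
      variance ▸ subgaussian.measure_ge_le hε
    _ = Real.exp (-Real.log η⁻¹) := by
      have := (sub_pos.2 h).ne'
      rw [hε_sq]
      congr 1
      field_simp
      norm_num
    _ = η := by rw [Real.log_inv, neg_neg, Real.exp_log hη]

theorem IsMeasurableClass.ofReal_le_measure_forall_abs_average_sub_integral_le
    (hF : IsMeasurableClass P F) (hm : ∀ f ∈ F, AEMeasurable f P)
    (hab : ∀ f ∈ F, ∀ x, f x ∈ Set.Icc a b) (h : a < b) {n : ℕ} (hn : n ≠ 0) {δ : ℝ}
    (hδ : 0 < δ) :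
    ENNReal.ofReal (1 - δ) ≤ (Measure.pi fun _ : Fin n => P)
      {x | ∀ f ∈ F, |(n : ℝ)⁻¹ * ∑ k, f (x k) - ∫ t, f t ∂P| ≤
        2 * rademacher P n F + (b - a) * √(Real.log (2 / δ) / (2 * n))} := by
  set μ : Measure (Fin n → X) := Measure.pi fun _ => P
  set t := 2 * rademacher P n F + (b - a) * √(Real.log (2 / δ) / (2 * n))
  set S := {x : Fin n → X | ∀ f ∈ F, |(n : ℝ)⁻¹ * ∑ k, f (x k) - ∫ t, f t ∂P| ≤ t}
  let tail (s : ℤˣ) : Set (Fin n → X) :=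
    {x | t ≤ supSum P F (fun _ => ((s : ℤ) : ℝ) * (n : ℝ)⁻¹) ((s : ℤ) : ℝ) x}
  rcases isEmpty_or_nonempty F with hempty | hne
  · have : S = Set.univ := Set.eq_univ_of_forall fun x f hf => hempty.elim ⟨f, hf⟩
    rw [this, measure_univ, ENNReal.ofReal_le_one]
    linarith
  have compl_subset : Sᶜ ⊆ tail 1 ∪ tail (-1) := by
    intro x hx
    contrapose! hx
    obtain ⟨hpos, hneg⟩ : _ < _ ∧ _ < _ := by simpa [tail] using hx
    refine not_not.2 fun f hf =>
      abs_average_sub_integral_le (abs_le_max_of_mem_Icc hab) (fun s => ?_) hf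
    rcases Int.units_eq_one_or s with rfl | rfl
    exacts [by simpa using hpos.le, by simpa using hneg.le]
  have htail (s) : μ (tail s) ≤ ENNReal.ofReal (δ / 2) := by
    rw [ENNReal.le_ofReal_iff_toReal_le (measure_ne_top _ _) (by positivity)]
    have := hF.measureReal_supSum_ge_le hm hab h hn s (half_pos hδ)
    rwa [inv_div] at this
  rw [ENNReal.ofReal_sub _ hδ.le, ENNReal.ofReal_one, tsub_le_iff_right]
  calc 1 = μ Set.univ := measure_univ.symm
    _ ≤ μ S + μ Sᶜ := measure_univ_le_add_compl S
    _ ≤ μ S + (μ (tail 1) + μ (tail (-1))) := by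
      gcongr
      exact (measure_mono compl_subset).trans (measure_union_le _ _)
    _ ≤ μ S + (ENNReal.ofReal (δ / 2) + ENNReal.ofReal (δ / 2)) := by gcongr <;> exact htail _
    _ = μ S + ENNReal.ofReal δ := by
      rw [← ENNReal.ofReal_add (by positivity) (by positivity), add_halves]

end Deviation

/-! ### The joint law of pattern and label -/

section JointLaw

variable {X : Type*} [MeasurableSpace X] (D : Measure (X × ℤˣ))

lemma isProbabilityMeasure_posLaw [IsFiniteMeasure D] (h : classPrior D ≠ 0) :
    IsProbabilityMeasure (posLaw D) := by
  have := cond_isProbabilityMeasure ((measureReal_ne_zero_iff (measure_ne_top _ _)).1 h)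
  exact Measure.isProbabilityMeasure_map measurable_fst.aemeasurable

lemma posLaw_absolutelyContinuous : posLaw D ≪ D.fst :=
  cond_absolutelyContinuous.map measurable_fst

variable [IsFiniteMeasure D]

lemma measurable_confidence : Measurable (confidence D) :=
  (Kernel.measurable_coe D.condKernel (measurableSet_singleton 1)).ennreal_toReal

lemma confidence_le_one (x : X) : confidence D x ≤ 1 := measureReal_le_one

lemma integral_eq_integral_confidence {φ : X × ℤˣ → ℝ} (hφ : Integrable φ D) :
    ∫ z, φ z ∂D =
      ∫ x, (confidence D x * φ (x, 1) + (1 - confidence D x) * φ (x, -1)) ∂D.fst := by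
  have compl_one : ({-1} : Set ℤˣ) = {1}ᶜ := by
    ext y
    rcases Int.units_eq_one_or y with rfl | rfl <;> simp
  have real_neg_one (x) : (D.condKernel x).real {-1} = 1 - confidence D x := by
    rw [compl_one, probReal_compl_eq_one_sub (measurableSet_singleton 1), confidence]
  rw [← Measure.integral_condKernel hφ]
  refine integral_congr_ae (.of_forall fun x => ?_)
  simp only [integral_fintype Integrable.of_finite, ← real_neg_one, smul_eq_mul]
  exact Finset.sum_pair (by decide)

lemma map_fst_restrict_eq_withDensity :
    (D.restrict (Prod.snd ⁻¹' {1})).map Prod.fst =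
      D.fst.withDensity fun x => D.condKernel x {1} := by
  ext s hs
  rw [Measure.map_apply measurable_fst hs, Measure.restrict_apply (measurable_fst hs),
    withDensity_apply _ hs,
    Measure.setLIntegral_condKernel_eq_measure_prod hs (measurableSet_singleton 1)]
  rfl

lemma integral_map_fst_restrict (f : X → ℝ) :
    ∫ x, f x ∂(D.restrict (Prod.snd ⁻¹' {1})).map Prod.fst = ∫ x, confidence D x * f x ∂D.fst := by
  rw [map_fst_restrict_eq_withDensity, integral_withDensity_eq_integral_toReal_smul
    (Kernel.measurable_coe _ (measurableSet_singleton 1)) (.of_forall fun _ => measure_lt_top _ _)]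
  rfl

lemma classPrior_eq_integral_confidence : classPrior D = ∫ x, confidence D x ∂D.fst := by
  have h := integral_map_fst_restrict D fun _ => 1
  simpa [classPrior, measureReal_def, Measure.map_apply measurable_fst] using h

lemma classPrior_mul_integral_posLaw (f : X → ℝ) :
    classPrior D * ∫ x, f x ∂(posLaw D) = ∫ x, confidence D x * f x ∂D.fst := by
  rw [← integral_map_fst_restrict, posLaw, ProbabilityTheory.cond, Measure.map_smul,
    integral_smul_measure, classPrior, measureReal_def, smul_eq_mul, ENNReal.toReal_inv]
  by_cases h : D (Prod.snd ⁻¹' {1}) = 0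
  · simp [Measure.restrict_eq_zero.2 h]
  · exact mul_inv_cancel_left₀ (ENNReal.toReal_ne_zero.2 ⟨h, measure_ne_top _ _⟩) _

lemma le_classPrior {D : Measure (X × ℤˣ)} [IsProbabilityMeasure D] {c : ℝ}
    (hr : ∀ᵐ x ∂D.fst, c ≤ confidence D x) : c ≤ classPrior D := by
  have hint : Integrable (confidence D) D.fst :=
    .of_mem_Icc 0 1 (measurable_confidence D).aemeasurable
      (.of_forall fun x => ⟨measureReal_nonneg, confidence_le_one D x⟩)
  calc c = ∫ _, c ∂D.fst := by simp
    _ ≤ ∫ x, confidence D x ∂D.fst := integral_mono_ae (integrable_const c) hint hr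
    _ = classPrior D := (classPrior_eq_integral_confidence D).symm

end JointLaw

/-! ### Pconf losses -/

section PconfLoss

variable {X : Type*} {r : X → ℝ} {ℓ : ℝ → ℝ} {f g : X → ℝ} {B C c : ℝ} {L : ℝ≥0} {x : X}

/-- The loss of `g` on a positive pattern, reweighted by the confidence `r` so that its mean under
the positive class-conditional law is `R(g) / π₊`. -/
noncomputable def pconfLoss (r : X → ℝ) (ℓ : ℝ → ℝ) (g : X → ℝ) (x : X) : ℝ :=
  ℓ (g x) + (1 - r x) / r x * ℓ (-g x)

lemma one_sub_div_mem_Icc {ρ : ℝ} (hc : 0 < c) (hρ : ρ ∈ Set.Icc c 1) :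
    (1 - ρ) / ρ ∈ Set.Icc 0 (1 / c) := by
  have hρ0 : 0 < ρ := hc.trans_le hρ.1
  refine ⟨div_nonneg (sub_nonneg.2 hρ.2) hρ0.le, ?_⟩
  calc (1 - ρ) / ρ ≤ 1 / ρ := by gcongr; linarith
    _ ≤ 1 / c := one_div_le_one_div_of_le hc hρ.1

lemma pconfLoss_mem_Icc (hc : 0 < c) (hr : r x ∈ Set.Icc c 1)
    (hℓ : ∀ z, |z| ≤ C → ℓ z ∈ Set.Icc 0 B) (hg : |g x| ≤ C) :
    pconfLoss r ℓ g x ∈ Set.Icc 0 (B + B / c) := by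
  obtain ⟨weight_nonneg, weight_le⟩ := one_sub_div_mem_Icc hc hr
  obtain ⟨loss_nonneg, loss_le⟩ := hℓ (g x) hg
  obtain ⟨loss_neg_nonneg, loss_neg_le⟩ := hℓ (-g x) ((abs_neg _).trans_le hg)
  refine ⟨add_nonneg loss_nonneg (mul_nonneg weight_nonneg loss_neg_nonneg), ?_⟩
  calc pconfLoss r ℓ g x ≤ B + 1 / c * B :=
        add_le_add loss_le (mul_le_mul weight_le loss_neg_le loss_neg_nonneg (by positivity))
    _ = B + B / c := by ring

lemma abs_pconfLoss_sub_le (hc : 0 < c) (hr : r x ∈ Set.Icc c 1)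
    (hLip : LipschitzOnWith L ℓ (Set.Icc (-C) C)) (hf : |f x| ≤ C) (hg : |g x| ≤ C) :
    |pconfLoss r ℓ f x - pconfLoss r ℓ g x| ≤ (L + L / c) * |f x - g x| := by
  obtain ⟨weight_nonneg, weight_le⟩ := one_sub_div_mem_Icc hc hr
  have loss_le : |ℓ (f x) - ℓ (g x)| ≤ L * |f x - g x| :=
    hLip.dist_le_mul (f x) (abs_le.1 hf) (g x) (abs_le.1 hg)
  have loss_neg_le : |ℓ (-f x) - ℓ (-g x)| ≤ L * |f x - g x| := by
    simpa only [Real.dist_eq, neg_sub_neg, abs_sub_comm (g x)] using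
      hLip.dist_le_mul (-f x) (abs_le.1 ((abs_neg _).trans_le hf)) (-g x)
        (abs_le.1 ((abs_neg _).trans_le hg))
  calc |pconfLoss r ℓ f x - pconfLoss r ℓ g x|
      = |(ℓ (f x) - ℓ (g x)) + (1 - r x) / r x * (ℓ (-f x) - ℓ (-g x))| := by
        rw [pconfLoss, pconfLoss]; ring_nf
    _ ≤ |ℓ (f x) - ℓ (g x)| + (1 - r x) / r x * |ℓ (-f x) - ℓ (-g x)| := by
        refine (abs_add_le _ _).trans_eq ?_
        rw [abs_mul, abs_of_nonneg weight_nonneg]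
    _ ≤ L * |f x - g x| + 1 / c * (L * |f x - g x|) :=
        add_le_add loss_le (mul_le_mul weight_le loss_neg_le (abs_nonneg _) (by positivity))
    _ = (L + L / c) * |f x - g x| := by ring

variable [MeasurableSpace X] {P : Measure X}

lemma aemeasurable_comp_of_lipschitzOnWith (hLip : LipschitzOnWith L ℓ (Set.Icc (-C) C))
    (hg : AEMeasurable g P) (hC : ∀ x, |g x| ≤ C) : AEMeasurable (fun x => ℓ (g x)) P := by
  obtain ⟨ℓ', hℓ', heq⟩ := hLip.extend_real
  exact (hℓ'.continuous.measurable.comp_aemeasurable hg).congr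
    (.of_forall fun x => (heq (abs_le.1 (hC x))).symm)

lemma aemeasurable_pconfLoss (hr : AEMeasurable r P)
    (hLip : LipschitzOnWith L ℓ (Set.Icc (-C) C)) (hg : AEMeasurable g P) (hC : ∀ x, |g x| ≤ C) :
    AEMeasurable (pconfLoss r ℓ g) P :=
  (aemeasurable_comp_of_lipschitzOnWith hLip hg hC).add
    (((hr.const_sub 1).div hr).mul
      (aemeasurable_comp_of_lipschitzOnWith hLip hg.neg fun x => (abs_neg (g x)).trans_le (hC x)))

lemma pconfLoss_congr_ae {ρ : X → ℝ} (h : r =ᵐ[P] ρ) (ℓ : ℝ → ℝ) (g : X → ℝ) :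
    pconfLoss r ℓ g =ᵐ[P] pconfLoss ρ ℓ g :=
  h.mono fun x hx => by simp only [pconfLoss, hx]

variable [IsProbabilityMeasure P] {G : Set (X → ℝ)}

lemma ae_forall_pconfLoss_eq {ρ : X → ℝ} (h : r =ᵐ[P] ρ) (ℓ : ℝ → ℝ) (n : ℕ) :
    ∀ᵐ x ∂(Measure.pi fun _ : Fin n => P), ∀ g k,
      pconfLoss r ℓ g (x k) = pconfLoss ρ ℓ g (x k) := by
  have hk (k : Fin n) := (Measure.quasiMeasurePreserving_eval (fun _ : Fin n => P) k).ae h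
  filter_upwards [ae_all_iff.2 hk] with x hx g k
  simp only [pconfLoss, hx k]

lemma IsMeasurableClass.lossClass_congr {ρ : X → ℝ}
    (hG : IsMeasurableClass P (lossClass r ℓ G)) (h : r =ᵐ[P] ρ) :
    IsMeasurableClass P (lossClass ρ ℓ G) := by
  intro n w b
  refine (hG n w b).congr ?_
  filter_upwards [ae_forall_pconfLoss_eq h ℓ n] with x hx
  change ⨆ f : pconfLoss r ℓ '' G, _ = ⨆ f : pconfLoss ρ ℓ '' G, _
  simp only [← (Set.imageFactorization_surjective (s := G)).iSup_comp, Set.imageFactorization,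
    hx, integral_congr_ae (pconfLoss_congr_ae h ℓ _)]

lemma ofReal_le_measure_forall_abs_average_pconfLoss_sub_integral_le (hc : 0 < c)
    (hrm : AEMeasurable r P) (hr : ∀ᵐ x ∂P, r x ∈ Set.Icc c 1) (hB : 0 < B)
    (hℓ : ∀ z, |z| ≤ C → ℓ z ∈ Set.Icc 0 B) (hLip : LipschitzOnWith L ℓ (Set.Icc (-C) C))
    (hGm : ∀ g ∈ G, AEMeasurable g P) (hGC : ∀ g ∈ G, ∀ x, |g x| ≤ C)
    (hG : IsMeasurableClass P G) (hloss : IsMeasurableClass P (lossClass r ℓ G))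
    {n : ℕ} (hn : n ≠ 0) {δ : ℝ} (hδ : 0 < δ) :
    ENNReal.ofReal (1 - δ) ≤ (Measure.pi fun _ : Fin n => P)
      {x | ∀ g ∈ G, |(n : ℝ)⁻¹ * ∑ k, pconfLoss r ℓ g (x k) - ∫ t, pconfLoss r ℓ g t ∂P| ≤
        2 * ((L + L / c) * rademacher P n G) + (B + B / c) * √(Real.log (2 / δ) / (2 * n))} := by
  wlog hr_mem : ∀ x, r x ∈ Set.Icc c 1 generalizing r with everywhere
  · obtain ⟨x₀, hx₀⟩ := hr.exists
    set ρ : X → ℝ := fun x => Set.projIcc c 1 (hx₀.1.trans hx₀.2) (r x)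
    have hρ_mem (x) : ρ x ∈ Set.Icc c 1 := Subtype.property _
    have hrρ : r =ᵐ[P] ρ :=
      hr.mono fun x hx => congrArg Subtype.val (Set.projIcc_of_mem _ hx).symm
    refine (everywhere (hrm.congr hrρ) (.of_forall hρ_mem) (hloss.lossClass_congr hrρ)
      hρ_mem).trans (measure_mono_ae ?_)
    filter_upwards [ae_forall_pconfLoss_eq hrρ ℓ n] with x hx hbound g hg
    simpa only [hx, integral_congr_ae (pconfLoss_congr_ae hrρ ℓ g)] using hbound g hg
  have loss_mem : ∀ g ∈ G, ∀ x, pconfLoss r ℓ g x ∈ Set.Icc 0 (B + B / c) :=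
    fun g hg x => pconfLoss_mem_Icc hc (hr_mem x) hℓ (hGC g hg x)
  have hbound := hloss.ofReal_le_measure_forall_abs_average_sub_integral_le
    (Set.forall_mem_image.2 fun g hg => aemeasurable_pconfLoss hrm hLip (hGm g hg) (hGC g hg))
    (Set.forall_mem_image.2 loss_mem) (by positivity) hn hδ
  refine hbound.trans (measure_mono fun x hx g hg => ?_)
  have : Nonempty G := ⟨g, hg⟩
  have contraction : rademacher P n (pconfLoss r ℓ '' G) ≤ (L + L / c) * rademacher P n G :=
    rademacher_image_le (by positivity) hG hGC hloss
      (fun g hg x => abs_le_max_abs_abs (loss_mem g hg x).1 (loss_mem g hg x).2)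
      (fun f hf g hg x => abs_pconfLoss_sub_le hc (hr_mem x) hLip (hGC f hf x) (hGC g hg x)) n
  refine (hx _ (Set.mem_image_of_mem _ hg)).trans ?_
  rw [sub_zero]
  gcongr
  exact contraction

end PconfLoss

/-! ### The Pconf risk -/

section Risk

variable {X : Type*} [MeasurableSpace X] {D : Measure (X × ℤˣ)} [IsFiniteMeasure D]
  {ℓ : ℝ → ℝ} {g : X → ℝ}

lemma integrable_loss_label_mul {B C : ℝ} {L : ℝ≥0} (hℓ : ∀ z, |z| ≤ C → ℓ z ∈ Set.Icc 0 B)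
    (hLip : LipschitzOnWith L ℓ (Set.Icc (-C) C)) (hg : Measurable g) (hC : ∀ x, |g x| ≤ C) :
    Integrable (fun z : X × ℤˣ => ℓ (((z.2 : ℤ) : ℝ) * g z.1)) D := by
  have margin_le (z : X × ℤˣ) : |((z.2 : ℤ) : ℝ) * g z.1| ≤ C := by
    rcases Int.units_eq_one_or z.2 with h | h <;> simpa [h] using hC z.1
  have label_measurable : Measurable fun y : ℤˣ => ((y : ℤ) : ℝ) := .of_discrete
  have margin_measurable : Measurable fun z : X × ℤˣ => ((z.2 : ℤ) : ℝ) * g z.1 :=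
    (label_measurable.comp measurable_snd).mul (hg.comp measurable_fst)
  exact .of_mem_Icc 0 B (aemeasurable_comp_of_lipschitzOnWith hLip margin_measurable.aemeasurable
    margin_le) (.of_forall fun z => hℓ _ (margin_le z))

lemma risk_eq_classPrior_mul_integral_pconfLoss (hr : ∀ᵐ x ∂D.fst, confidence D x ≠ 0)
    (hint : Integrable (fun z : X × ℤˣ => ℓ (((z.2 : ℤ) : ℝ) * g z.1)) D) :
    risk D ℓ g = classPrior D * ∫ x, pconfLoss (confidence D) ℓ g x ∂posLaw D := by
  rw [classPrior_mul_integral_posLaw, risk, integral_eq_integral_confidence D hint]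
  refine integral_congr_ae (hr.mono fun x hx => ?_)
  simp only [pconfLoss, Units.val_one, Units.val_neg, Int.cast_one, Int.cast_neg, one_mul,
    neg_one_mul]
  field_simp

lemma empiricalRisk_sub_risk {n : ℕ} (hr : ∀ᵐ x ∂D.fst, confidence D x ≠ 0)
    (hint : Integrable (fun z : X × ℤˣ => ℓ (((z.2 : ℤ) : ℝ) * g z.1)) D) (x : Fin n → X) :
    empiricalRisk (classPrior D) ℓ (fun i => (x i, confidence D (x i))) g - risk D ℓ g =
      classPrior D * ((n : ℝ)⁻¹ * ∑ i, pconfLoss (confidence D) ℓ g (x i) -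
        ∫ t, pconfLoss (confidence D) ℓ g t ∂posLaw D) := by
  rw [risk_eq_classPrior_mul_integral_pconfLoss hr hint, mul_sub]
  rfl

end Risk

end Pconf

theorem lemma1 {X : Type*} [MeasurableSpace X]
    -- the joint law of (pattern, label)
    (D : Measure (X × ℤˣ)) [IsProbabilityMeasure D]
    -- the function class, uniformly bounded by `Cg`
    (G : Set (X → ℝ)) (hGm : ∀ g ∈ G, Measurable g)
    (Cg : ℝ) (hCg : 0 < Cg) (hG : ∀ g ∈ G, ∀ x, |g x| ≤ Cg)
    -- the nonnegative loss, bounded by `Cl` and Lipschitz with constant `Ll` on `[-Cg, Cg]`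
    (ℓ : ℝ → ℝ) (hℓ : ∀ z, |z| ≤ Cg → 0 ≤ ℓ z)
    (Cl : ℝ) (hCl : 0 < Cl) (hℓC : ∀ z, |z| ≤ Cg → ℓ z ≤ Cl)
    (Ll : NNReal) (hLip : LipschitzOnWith Ll ℓ (Set.Icc (-Cg) Cg))
    -- the confidence is bounded away from zero almost surely
    (Cr : ℝ) (hCr : 0 < Cr) (hr : ∀ᵐ x ∂D.fst, Cr ≤ Pconf.confidence D x)
    -- measurability of the suprema over the function class
    (hmG : Pconf.IsMeasurableClass (Pconf.posLaw D) G)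
    (hmL : Pconf.IsMeasurableClass (Pconf.posLaw D) (Pconf.lossClass (Pconf.confidence D) ℓ G))
    (n : ℕ) (hn : 0 < n) (δ : ℝ) (hδ : 0 < δ) :
    ENNReal.ofReal (1 - δ) ≤
      (Measure.pi fun _ : Fin n => Pconf.posLaw D)
        {x | (⨆ g ∈ G,
              ((|Pconf.empiricalRisk (Pconf.classPrior D) ℓ
                    (fun i => (x i, Pconf.confidence D (x i))) g
                  - Pconf.risk D ℓ g| : ℝ) : EReal)) ≤
            ((2 * Pconf.classPrior D * (Ll + Ll / Cr) * Pconf.rademacher (Pconf.posLaw D) n G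
              + Pconf.classPrior D * (Cl + Cl / Cr) * √(Real.log (2 / δ) / (2 * n)) : ℝ) :
              EReal)} := by
  open Pconf in
  have hℓ_mem : ∀ z, |z| ≤ Cg → ℓ z ∈ Set.Icc 0 Cl := fun z hz => ⟨hℓ z hz, hℓC z hz⟩
  have prior_pos : 0 < classPrior D := hCr.trans_le (le_classPrior hr)
  have := isProbabilityMeasure_posLaw D prior_pos.ne'
  have hr_mem : ∀ᵐ x ∂posLaw D, confidence D x ∈ Set.Icc Cr 1 :=
    (posLaw_absolutelyContinuous D).ae_le (hr.mono fun x hx => ⟨hx, confidence_le_one D x⟩)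
  have hr_ne : ∀ᵐ x ∂D.fst, confidence D x ≠ 0 := hr.mono fun x hx => (hCr.trans_le hx).ne'
  refine (ofReal_le_measure_forall_abs_average_pconfLoss_sub_integral_le hCr
    (measurable_confidence D).aemeasurable hr_mem hCl hℓ_mem hLip
    (fun g hg => (hGm g hg).aemeasurable) hG hmG hmL hn.ne' hδ).trans (measure_mono ?_)
  intro x deviation_le
  refine iSup₂_le fun g hg => EReal.coe_le_coe_iff.2 ?_
  rw [empiricalRisk_sub_risk hr_ne (integrable_loss_label_mul hℓ_mem hLip (hGm g hg) (hG g hg)),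
    abs_mul, abs_of_pos prior_pos]
  refine (mul_le_mul_of_nonneg_left (deviation_le g hg) prior_pos.le).trans_eq ?_
  ring
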